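/- **Theorem 3.** Let $\|\cdot\|$ be the norm of $L^2(0,1)$, $|\cdot|$ the Euclidean norm, $s^+=\max(s,0)$, $\mathbb{R}_+=[0,+\infty)$, and let $\|\cdot\|_\infty$ be the essential supremum norm on $\mathbb{R}_+$. Let $\varepsilon,\Gamma>0$, $c\ge 1$, $b\ge 1\ge a>0$ and $p>0$ be constants, let $K:[0,1]\times\mathbb{R}\to\mathbb{R}$ be a function and $L:H^2(0,1)\cap H_0^1(0,1)\to\mathbb{R}$ a (not necessarily linear) functional with $$|K(x,y)|\le |y|,\qquad |L(v)|\le \|v\|\qquad\text{for all } x\in[0,1],\ y\in\mathbb{R},\ v\in H^2(0,1)\cap H_0^1(0,1),$$ and let $d\in L^\infty(\mathbb{R}_+)$ and $\theta=(\theta_1,\theta_2)\in C^0(\mathbb{R}_+;\mathbb{R}^2)\cap L^\infty(\mathbb{R}_+;\mathbb{R}^2)$. Let $$w\in C^0(\mathbb{R}_+;L^2(0,1))\cap C^1((0,+\infty);L^2(0,1))\cap C^0((0,+\infty);H^2(0,1)\cap H_0^1(0,1)),\qquad z\in C^1(\mathbb{R}_+),\qquad y\in C^0(\mathbb{R}_+),$$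 with $y$ absolutely continuous on every compact interval of $\mathbb{R}_+$, be a solution of the closed-loop system $$w_t[t]=p\,w_{xx}[t]+\theta_1(t)K(\cdot,y(t)) \text{ in } L^2(0,1)\quad\text{and}\quad \dot z(t)=\Gamma e^{-z(t)}\Big(\tfrac{y^2(t)}{2}-\varepsilon\Big)^+\quad\text{for all } t>0,$$ $$\dot y(t)=u(t)+\theta_2(t)L(w[t])+d(t)\quad\text{for almost all } t>0,$$ where $$u(t)=-c\left(1+\frac{(b+e^{z(t)})^7}{4a^6}\right)\left(y^7(t)+y^3(t)+y(t)\right).$$ Set $$\kappa=\min\Big(\frac{p\pi^2}{2},2c\Big),\quad \bar K=\frac{4p\pi^2(b\kappa+ap\pi^2)+2b\kappa p^2\pi^4+b}{4p\pi^2b\kappa},\quad \bar B=\frac{a\bar K(\varepsilon\Gamma+2c)+\varepsilon c\Gamma}{4c^2\varepsilon}.$$ Then for all $t\ge 0$ $$\|w[t]\|^2+y^2(t)\le e^{-\kappa t}\left(\|w[0]\|^2+y^2(0)\right)+2a\,\frac{\|d\|_\infty^2+\|\theta\|_\infty^8+2p^{-2}}{b\kappa}+\frac{\|\theta\|_\infty^4}{2p^2\pi^4\kappa},$$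 $$z(0)\le z(t)\le\ln\left(e^{z(0)}+\bar B\left(\|d\|_\infty^2+\|\theta\|_\infty^4+\|\theta\|_\infty^8+2p^{-2}+\|w[0]\|^2+y^2(0)\right)\right),$$ and moreover $$\limsup_{t\to+\infty}\|w[t]\|\le\frac{\sqrt{2\varepsilon}}{p\pi^2}\limsup_{t\to+\infty}|\theta_1(t)|,\qquad \limsup_{t\to+\infty}|y(t)|\le\sqrt{2\varepsilon}.$$ -/

import Mathlib

open MeasureTheory Filter Set Topology
open scoped ENNReal ContDiff

namespace DADS

/-- Lebesgue measure on the open interval `(0, 1)`. -/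
noncomputable def unitMeasure : Measure ℝ := volume.restrict (Ioo (0 : ℝ) 1)

/-- The Hilbert space `L²(0, 1)`. -/
abbrev L2 : Type := Lp ℝ 2 unitMeasure

/-- `g` is the weak derivative of `f` on `(0, 1)`: for every test function `φ ∈ C_c^∞(0, 1)`
one has `∫ f φ' = - ∫ g φ`. -/
def IsWeakDeriv (f g : L2) : Prop :=
  ∀ φ : ℝ → ℝ, ContDiff ℝ ∞ φ → HasCompactSupport φ → tsupport φ ⊆ Ioo (0 : ℝ) 1 →
    ∫ x, f x * deriv φ x ∂unitMeasure = - ∫ x, g x * φ x ∂unitMeasure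

/-- Weak derivatives are unique, so that the pairs and triples below stand for functions. -/
theorem IsWeakDeriv.unique {f g h : L2} (hg : IsWeakDeriv f g) (hh : IsWeakDeriv f h) : g = h := by
  haveI : IsFiniteMeasure unitMeasure := by unfold unitMeasure; infer_instance
  apply Lp.ext
  have int : ∀ f : L2, Integrable f unitMeasure := fun f =>
    (Lp.memLp f).integrable (by norm_num)
  have := IsOpen.ae_eq_zero_of_integral_contDiff_smul_eq_zero (μ := volume) (U := Ioo (0:ℝ) 1)
    (f := fun x => g x - h x) isOpen_Ioo
    (by
      have : IntegrableOn (fun x => g x - h x) (Ioo 0 1) volume := by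
        rw [IntegrableOn]; exact (int g).sub (int h)
      exact this.locallyIntegrableOn) (by
    intro φ h1 h2 h3
    have e := (hg φ h1 h2 h3).symm.trans (hh φ h1 h2 h3)
    have ig : ∀ f : L2, Integrable (fun x => f x * φ x) unitMeasure := fun f => by
      obtain ⟨C, hC⟩ := h2.exists_bound_of_continuous h1.continuous
      exact (int f).mul_bdd (c := C) h1.continuous.aestronglyMeasurable (Eventually.of_forall hC)
    have e2 : ∫ x, φ x • (g x - h x) ∂unitMeasure = 0 := by
      simp only [smul_eq_mul, mul_comm (φ _), sub_mul]
      rw [integral_sub (ig g) (ig h)]; linarith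
    rw [← setIntegral_eq_integral_of_forall_compl_eq_zero (s := Ioo (0:ℝ) 1)]
    · exact e2
    · intro x hx
      have : φ x = 0 := image_eq_zero_of_notMem_tsupport (fun h => hx (h3 h))
      simp [this])
  have h2 := (ae_restrict_iff' measurableSet_Ioo).2 this
  filter_upwards [h2] with x hx
  linarith
/-- The Sobolev space `H¹(0, 1)`. A function `f` is recorded together with its (unique) weak
derivative as the pair `(f, f')`; the topology induced by `L² × L²` is that of the `H¹` norm. -/
def H1 : Set (L2 × L2) := {q | IsWeakDeriv q.1 q.2}

/-- The pairs `(φ, φ')` for `φ` of class `C¹` with compact support in `(0, 1)`. -/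
def C1Compact : Set (L2 × L2) :=
  {q | ∃ φ : ℝ → ℝ, ContDiff ℝ 1 φ ∧ HasCompactSupport φ ∧ tsupport φ ⊆ Ioo (0 : ℝ) 1 ∧
    (∀ᵐ x ∂unitMeasure, q.1 x = φ x) ∧ (∀ᵐ x ∂unitMeasure, q.2 x = deriv φ x)}

/-- The space `H₀¹(0, 1)`: the closure in `H¹(0, 1)` of the compactly supported `C¹` functions. -/
def H10 : Set (L2 × L2) := H1 ∩ closure C1Compact

/-- The space `H²(0, 1) ∩ H₀¹(0, 1)`. A function `f` is recorded together with its (unique) weak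
derivatives as the triple `(f, f', f'')`; the topology induced by `L² × L² × L²` is that of the
`H²` norm. -/
def H2H10 : Set (L2 × L2 × L2) :=
  {q | (q.1, q.2.1) ∈ H10 ∧ (q.2.1, q.2.2) ∈ H1}

/-- The element of `L²(0, 1)` underlying an element of `H² ∩ H₀¹`. -/
def H2H10.toL2 (q : H2H10) : L2 := (q : L2 × L2 × L2).1

/-- The second weak derivative of an element of `H² ∩ H₀¹`. -/
def H2H10.dxx (q : H2H10) : L2 := (q : L2 × L2 × L2).2.2

/-- The norm `‖f‖_∞` of `L^∞(ℝ₊; E)`, as a real number. -/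
noncomputable def supNorm {E : Type*} [NormedAddCommGroup E] (f : ℝ → E) : ℝ :=
  (eLpNorm f ∞ (volume.restrict (Ici (0 : ℝ)))).toReal

/-- The feedback law `u`, as a function of the measured state `y` and the gain `z`. -/
noncomputable def feedback (a b c y z : ℝ) : ℝ :=
  -c * (1 + (b + Real.exp z) ^ 7 / (4 * a ^ 6)) * (y ^ 7 + y ^ 3 + y)

/-- The right-hand side of the update law of the gain `z`, with `V(y) = y² / 2`. -/
noncomputable def update (ε Γ y z : ℝ) : ℝ :=
  Γ * Real.exp (-z) * max (y ^ 2 / 2 - ε) 0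

/-- `(w, y, z)` is a solution on `[0, ∞)`, in the regularity class of the theorem, of the
closed-loop system
`w_t = p w_xx + θ₁ K(x, y)`, `w(0) = w(1) = 0`, `y' = u + θ₂ L(w) + d`, `u` the feedback law,
`z' = Γ e^{-z} (V(y) - ε)⁺`. The function `W` is the curve `w` on `(0, ∞)`, seen as a curve in
`H² ∩ H₀¹`. The components `θ₁, θ₂` of `θ` are `θ t 0` and `θ t 1`. -/
structure IsSolution (ε Γ a b c p : ℝ) (K : ℝ → ℝ → ℝ) (L : H2H10 → ℝ)
    (d : ℝ → ℝ) (θ : ℝ → EuclideanSpace ℝ (Fin 2))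
    (w : ℝ → L2) (W : ℝ → H2H10) (y z : ℝ → ℝ) : Prop where
  w_continuous : ContinuousOn w (Ici 0)
  w_contDiff : ContDiffOn ℝ 1 w (Ioi 0)
  W_eq : ∀ t > 0, H2H10.toL2 (W t) = w t
  W_continuous : ContinuousOn W (Ioi 0)
  z_contDiff : ContDiffOn ℝ 1 z (Ici 0)
  y_continuous : ContinuousOn y (Ici 0)
  y_absCont : ∀ s t : ℝ, 0 ≤ s → s ≤ t → AbsolutelyContinuousOnInterval y s t
  w_eqn : ∀ t > 0, ∀ᵐ x ∂unitMeasure,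
    deriv w t x = p * H2H10.dxx (W t) x + θ t 0 * K x (y t)
  z_eqn : ∀ t > 0, HasDerivAt z (update ε Γ (y t) (z t)) t
  y_eqn : ∀ᵐ t ∂(volume.restrict (Ioi (0 : ℝ))),
    HasDerivAt y (feedback a b c (y t) (z t) + θ t 1 * L (W t) + d t) t

/-- The decay rate `κ`. -/
noncomputable def kappa (p c : ℝ) : ℝ := min (p * Real.pi ^ 2 / 2) (2 * c)

/-- The constant `K̄`. -/
noncomputable def Kbar (a b c p : ℝ) : ℝ :=
  (4 * p * Real.pi ^ 2 * (b * kappa p c + a * p * Real.pi ^ 2)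
      + 2 * b * kappa p c * p ^ 2 * Real.pi ^ 4 + b)
    / (4 * p * Real.pi ^ 2 * b * kappa p c)

/-- The constant `B̄`. -/
noncomputable def Bbar (ε Γ a b c p : ℝ) : ℝ :=
  (a * Kbar a b c p * (ε * Γ + 2 * c) + ε * c * Γ) / (4 * c ^ 2 * ε)

end DADS

/-! Write V = y²/2, F = e^z and S for the size of the data multiplied by B̄ in the bound on z.
Energy: the Dirichlet Laplacian is at most -π² (`H2H10.inner_dxx_le`, by Wirtinger's inequality), so
‖w‖² + y² is dissipated at rate κ. Whatever the value of z, the cubic part of the feedback absorbs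
the products with θ and the linear part, times the gain, absorbs d (`energy_dissipation`). Grönwall
gives the bound on the state. Attenuation: with ‖w‖ now bounded by the data, spending the feedback
differently gives V' ≤ -2cV + aK̄S/(b + F), so a larger gain leaves a smaller residual
(`output_dissipation`, `disturbance_le`). Gain: F' = Γ(V - ε)⁺. Once F exceeds a fixed threshold,
the residual is at most 2cε and F + Γ/(2c)·(V - ε)⁺ no longer increases. Hence F is bounded
(`gain_le`). Asymptotics: F is monotone and bounded while V' is bounded above, which forces V below
ε + δ eventually (`eventually_le_of_bounded_gain`). The heat equation is then driven by a source of
norm at most about |θ₁|√(2ε) and damped at rate pπ², whence the limsup of ‖w‖. -/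

namespace DADS

/-! ### Mollification and integration by parts in H₀¹. -/

open scoped Convolution in
/-- A compactly supported `C¹` function in an open set is approximated, uniformly together with its
derivative, by smooth functions compactly supported in that set. -/
theorem exists_contDiff_approx_of_contDiff_one {φ : ℝ → ℝ} {U : Set ℝ} (hU : IsOpen U)
    (h1 : ContDiff ℝ 1 φ) (h2 : HasCompactSupport φ) (h3 : tsupport φ ⊆ U) {η : ℝ} (hη : 0 < η) :
    ∃ ψ : ℝ → ℝ, ContDiff ℝ ∞ ψ ∧ HasCompactSupport ψ ∧ tsupport ψ ⊆ U ∧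
      (∀ x, |ψ x - φ x| ≤ η) ∧ ∀ x, |deriv ψ x - deriv φ x| ≤ η := by
  obtain ⟨δ₀, hδ₀, hδU⟩ := h2.isCompact.exists_cthickening_subset_open hU h3
  have hd : Continuous (deriv φ) := h1.continuous_deriv le_rfl
  have u1 := h2.uniformContinuous_of_continuous h1.continuous
  have u2 := h2.deriv.uniformContinuous_of_continuous hd
  obtain ⟨δ₁, hδ₁, H1⟩ := Metric.uniformContinuous_iff.1 u1 η hη
  obtain ⟨δ₂, hδ₂, H2⟩ := Metric.uniformContinuous_iff.1 u2 η hη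
  set δ := min δ₀ (min δ₁ δ₂) with hδdef
  have hδ : 0 < δ := by positivity
  let ρ : ContDiffBump (0 : ℝ) := ⟨δ / 2, δ, half_pos hδ, half_lt_self hδ⟩
  let ψ : ℝ → ℝ := ρ.normed volume ⋆[ContinuousLinearMap.lsmul ℝ ℝ, volume] φ
  have hderiv : ∀ x, deriv ψ x =
      (ρ.normed volume ⋆[ContinuousLinearMap.lsmul ℝ ℝ, volume] deriv φ) x := fun x =>
    (h2.hasDerivAt_convolution_right _ ρ.continuous_normed.locallyIntegrable h1 x).deriv
  have hsupp : Function.support ψ ⊆ Metric.cthickening δ₀ (tsupport φ) := by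
    intro x hx
    by_contra hc
    have hz : ∀ t ∈ Metric.ball x δ₀, φ t = 0 := by
      intro t ht
      by_contra h
      exact hc (Metric.mem_cthickening_of_dist_le x t δ₀ _ (subset_tsupport _ h)
        (by rw [dist_comm]; exact (Metric.mem_ball.1 ht).le))
    -- Tolerance `0`: φ is constantly zero on the ball being averaged, so the average equals φ x = 0
    -- exactly.
    have := ρ.dist_normed_convolution_le (μ := volume) (x₀ := x) (ε := 0)
      h1.continuous.aestronglyMeasurable (by
        intro t ht
        rw [hz t (Metric.ball_subset_ball (min_le_left _ _) ht),
          hz x (Metric.mem_ball_self hδ₀), dist_self])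
    rw [hz x (Metric.mem_ball_self hδ₀)] at this
    exact hx (dist_le_zero.1 this)
  have hcomp : IsCompact (Metric.cthickening δ₀ (tsupport φ)) := h2.isCompact.cthickening
  refine ⟨ψ, ?_, HasCompactSupport.of_support_subset_isCompact hcomp hsupp,
    (closure_minimal hsupp Metric.isClosed_cthickening).trans hδU, ?_, ?_⟩
  · exact ρ.hasCompactSupport_normed.contDiff_convolution_left _ ρ.contDiff_normed
      h1.continuous.locallyIntegrable
  · intro x
    rw [← Real.dist_eq]
    refine ρ.dist_normed_convolution_le h1.continuous.aestronglyMeasurable fun t ht => (H1 ?_).le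
    exact (Metric.mem_ball.1 ht).trans_le ((min_le_right _ _).trans (min_le_left _ _))
  · intro x
    rw [hderiv, ← Real.dist_eq]
    refine ρ.dist_normed_convolution_le hd.aestronglyMeasurable fun t ht => (H2 ?_).le
    exact (Metric.mem_ball.1 ht).trans_le ((min_le_right _ _).trans (min_le_right _ _))

instance : IsProbabilityMeasure unitMeasure := ⟨by simp [unitMeasure]⟩

theorem L2.integrable (f : L2) : Integrable f unitMeasure :=
  (Lp.memLp f).integrable (by norm_num)

theorem L2.integrable_mul_of_bounded (f : L2) {φ : ℝ → ℝ} (hφ : Continuous φ) {C : ℝ}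
    (hC : ∀ x, |φ x| ≤ C) : Integrable (fun x => f x * φ x) unitMeasure :=
  (L2.integrable f).mul_bdd (c := C) hφ.aestronglyMeasurable (Eventually.of_forall hC)

theorem L2.abs_integral_mul_le (f : L2) {φ : ℝ → ℝ} {C : ℝ}
    (hC : ∀ x, |φ x| ≤ C) :
    |∫ x, f x * φ x ∂unitMeasure| ≤ C * ∫ x, |f x| ∂unitMeasure := by
  rw [← integral_const_mul]
  refine norm_integral_le_of_norm_le (f := fun x => f x * φ x)
    ((L2.integrable f).abs.const_mul C) (Eventually.of_forall ?_)
  intro x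
  rw [norm_mul, mul_comm]
  exact mul_le_mul_of_nonneg_right (hC x) (norm_nonneg _)

/-- The defining identity of a weak derivative extends to `C¹` test functions. -/
theorem IsWeakDeriv.integral_eq_of_contDiff_one {f g : L2} (h : IsWeakDeriv f g) {φ : ℝ → ℝ}
    (h1 : ContDiff ℝ 1 φ) (h2 : HasCompactSupport φ) (h3 : tsupport φ ⊆ Ioo (0 : ℝ) 1) :
    ∫ x, f x * deriv φ x ∂unitMeasure = - ∫ x, g x * φ x ∂unitMeasure := by
  set M := ∫ x, |f x| ∂unitMeasure + ∫ x, |g x| ∂unitMeasure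
  have hM : 0 ≤ M := add_nonneg (integral_nonneg fun _ => abs_nonneg _)
    (integral_nonneg fun _ => abs_nonneg _)
  have int : ∀ (u : L2) {χ : ℝ → ℝ}, Continuous χ → HasCompactSupport χ →
      Integrable (fun x => u x * χ x) unitMeasure := fun u χ hχ hc => by
    obtain ⟨C, hC⟩ := hc.exists_bound_of_continuous hχ
    exact L2.integrable_mul_of_bounded u hχ hC
  have key : ∀ η > 0, |∫ x, f x * deriv φ x ∂unitMeasure + ∫ x, g x * φ x ∂unitMeasure|
      ≤ η * M := by
    intro η hη
    obtain ⟨ψ, p1, p2, p3, p4, p5⟩ := exists_contDiff_approx_of_contDiff_one isOpen_Ioo h1 h2 h3 hη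
    have e := h ψ p1 p2 p3
    have p1' : ContDiff ℝ 1 ψ := p1.of_le (by exact_mod_cast le_top)
    have a1 := L2.abs_integral_mul_le f p5
    have a2 := L2.abs_integral_mul_le g p4
    simp only [mul_sub] at a1 a2
    rw [integral_sub (int f (p1'.continuous_deriv le_rfl) p2.deriv)
      (int f (h1.continuous_deriv le_rfl) h2.deriv)] at a1
    rw [integral_sub (int g p1.continuous p2) (int g h1.continuous h2)] at a2
    rw [abs_le] at *
    rw [mul_add]
    constructor <;> linarith [a1.1, a1.2, a2.1, a2.2]
  have : |∫ x, f x * deriv φ x ∂unitMeasure + ∫ x, g x * φ x ∂unitMeasure| ≤ 0 := by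
    refine le_of_forall_pos_le_add fun ε hε => ?_
    refine (key (ε / (M + 1)) (by positivity)).trans ?_
    rw [zero_add, div_mul_eq_mul_div, div_le_iff₀ (by positivity)]
    nlinarith
  linarith [abs_nonpos_iff.1 this]

theorem L2.inner_eq (f g : L2) : inner ℝ f g = ∫ x, f x * g x ∂unitMeasure := by
  rw [MeasureTheory.L2.inner_def]
  simp only [RCLike.inner_apply, conj_trivial, mul_comm]

/-- Integration by parts against an element of `H₀¹`. -/
theorem IsWeakDeriv.inner_eq_neg_inner {f g : L2} (h : IsWeakDeriv f g) {q : L2 × L2}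
    (hq : q ∈ closure C1Compact) : inner ℝ f q.2 = - inner ℝ g q.1 := by
  have hcl : IsClosed {q : L2 × L2 | inner ℝ f q.2 = - inner ℝ g q.1} :=
    isClosed_eq (by fun_prop) (by fun_prop)
  refine closure_minimal ?_ hcl hq
  rintro ⟨u, v⟩ ⟨φ, h1, h2, h3, hu, hv⟩
  simp only [mem_ofPred_eq, L2.inner_eq]
  have e1 : ∫ x, f x * v x ∂unitMeasure = ∫ x, f x * deriv φ x ∂unitMeasure :=
    integral_congr_ae (by filter_upwards [hv] with x hx; simp [hx])
  have e2 : ∫ x, g x * u x ∂unitMeasure = ∫ x, g x * φ x ∂unitMeasure :=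
    integral_congr_ae (by filter_upwards [hu] with x hx; simp [hx])
  rw [e1, e2]
  exact h.integral_eq_of_contDiff_one h1 h2 h3

/-! ### Wirtinger's inequality and the Dirichlet Laplacian. -/

/-- Wirtinger's inequality for `C¹` functions compactly supported in `(0, 1)`. -/
theorem sq_pi_mul_integral_sq_le {φ : ℝ → ℝ} (h1 : ContDiff ℝ 1 φ) (h2 : HasCompactSupport φ)
    (h3 : tsupport φ ⊆ Ioo (0 : ℝ) 1) :
    Real.pi ^ 2 * ∫ x, φ x ^ 2 ≤ ∫ x, deriv φ x ^ 2 := by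
  have hd : Continuous (deriv φ) := h1.continuous_deriv le_rfl
  have hsin : ∀ x ∈ tsupport φ, Real.sin (Real.pi * x) ≠ 0 := fun x hx => by
    obtain ⟨a, b⟩ := h3 hx
    refine (Real.sin_pos_of_pos_of_lt_pi (by positivity) ?_).ne'
    nlinarith [Real.pi_pos]
  -- k = π cot(πx) is the logarithmic derivative of the ground state sin(πx) and solves k' = -(π² +
  -- k²). Therefore φ'² - π²φ² = (kφ²)' + (φ' - kφ)², and the exact derivative integrates to zero.
  -- The poles of k at 0 and 1 lie off the support of φ.
  set k : ℝ → ℝ := fun x => Real.pi * Real.cos (Real.pi * x) / Real.sin (Real.pi * x) with hk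
  set h : ℝ → ℝ := fun x => k x * φ x ^ 2 with hh
  set h' : ℝ → ℝ := fun x => 2 * k x * φ x * deriv φ x - (Real.pi ^ 2 + k x ^ 2) * φ x ^ 2 with hh'
  have hk' : ∀ x, Real.sin (Real.pi * x) ≠ 0 → HasDerivAt k (-(Real.pi ^ 2 + k x ^ 2)) x := by
    intro x hx
    have hl : HasDerivAt (fun x : ℝ => Real.pi * x) Real.pi x := by
      simpa using (hasDerivAt_id x).const_mul Real.pi
    convert! ((hl.cos).const_mul Real.pi).div hl.sin hx using 1
    simp only [hk]
    field_simp
    ring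
  have hzero : ∀ x ∉ tsupport φ, φ x = 0 := fun x => image_eq_zero_of_notMem_tsupport
  have hzero' : ∀ x ∉ tsupport φ, deriv φ x = 0 := fun x hx => by
    have : φ =ᶠ[𝓝 x] fun _ => 0 := notMem_tsupport_iff_eventuallyEq.1 hx
    simpa using this.deriv_eq
  have hderiv : ∀ x, HasDerivAt h (h' x) x := by
    intro x
    by_cases hx : x ∈ tsupport φ
    · have := (hk' x (hsin x hx)).mul (((h1.differentiable (by norm_num)) x).hasDerivAt.pow 2)
      convert! this using 1
      simp only [hh', Pi.pow_apply]
      push_cast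
      ring
    · have e : h' x = 0 := by simp [hh', hzero x hx]
      rw [e]
      have : h =ᶠ[𝓝 x] fun _ => 0 := by
        filter_upwards [notMem_tsupport_iff_eventuallyEq.1 hx] with t ht
        simp only [hh]
        rw [ht]; simp
      exact (hasDerivAt_const x (0 : ℝ)).congr_of_eventuallyEq this
  have hkc : ∀ x ∈ tsupport φ, ContinuousAt k x := fun x hx => (hk' x (hsin x hx)).continuousAt
  have cont : ∀ {g : ℝ → ℝ}, (∀ x ∈ tsupport φ, ContinuousAt g x) → Continuous (fun x => g x * φ x) := by
    intro g hg
    refine continuous_iff_continuousAt.2 fun x => ?_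
    by_cases hx : x ∈ tsupport φ
    · exact (hg x hx).mul h1.continuous.continuousAt
    · have : (fun x => g x * φ x) =ᶠ[𝓝 x] fun _ => 0 := by
        filter_upwards [notMem_tsupport_iff_eventuallyEq.1 hx] with t ht
        rw [ht]; simp
      exact continuousAt_const.congr this.symm
  have ckφ : Continuous (fun x => k x * φ x) := cont hkc
  have csupp : ∀ {g : ℝ → ℝ}, (∀ x ∉ tsupport φ, g x = 0) → Continuous g → Integrable g := by
    intro g hg hc
    exact hc.integrable_of_hasCompactSupport (HasCompactSupport.intro h2.isCompact hg)
  have ch : Continuous h := by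
    have : h = fun x => (k x * φ x) * φ x := by funext x; simp only [hh]; ring
    rw [this]; exact ckφ.mul h1.continuous
  have ch' : Continuous h' := by
    have : h' = fun x => 2 * (k x * φ x) * deriv φ x - Real.pi ^ 2 * φ x ^ 2 - (k x * φ x) ^ 2 := by
      funext x; simp only [hh']; ring
    rw [this]
    exact ((((continuous_const.mul ckφ).mul hd).sub
      (continuous_const.mul (h1.continuous.pow 2))).sub (ckφ.pow 2))
  have ih : Integrable h := csupp (fun x hx => by simp [hh, hzero x hx]) ch
  have ih' : Integrable h' := csupp (fun x hx => by simp [hh', hzero x hx]) ch'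
  have i1 : Integrable (fun x => φ x ^ 2) :=
    csupp (fun x hx => by simp [hzero x hx]) (h1.continuous.pow 2)
  have i2 : Integrable (fun x => deriv φ x ^ 2) :=
    csupp (fun x hx => by simp [hzero' x hx]) (hd.pow 2)
  have e0 := integral_eq_zero_of_hasDerivAt_of_integrable hderiv ih' ih
  have : ∫ x, Real.pi ^ 2 * φ x ^ 2 + h' x ≤ ∫ x, deriv φ x ^ 2 := by
    refine integral_mono ((i1.const_mul _).add ih') i2 fun x => ?_
    simp only [hh']
    nlinarith [sq_nonneg (deriv φ x - k x * φ x)]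
  rw [integral_add (i1.const_mul _) ih', e0, integral_const_mul] at this
  linarith

/-- Wirtinger's inequality on `H₀¹(0, 1)`. -/
theorem sq_pi_mul_norm_sq_le {q : L2 × L2} (hq : q ∈ closure C1Compact) :
    Real.pi ^ 2 * ‖q.1‖ ^ 2 ≤ ‖q.2‖ ^ 2 := by
  have hcl : IsClosed {q : L2 × L2 | Real.pi ^ 2 * ‖q.1‖ ^ 2 ≤ ‖q.2‖ ^ 2} :=
    isClosed_le (by fun_prop) (by fun_prop)
  refine closure_minimal ?_ hcl hq
  rintro ⟨u, v⟩ ⟨φ, h1, h2, h3, hu, hv⟩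
  have key := sq_pi_mul_integral_sq_le h1 h2 h3
  have hs : ∀ {g : ℝ → ℝ}, (∀ x ∉ tsupport φ, g x = 0) →
      ∫ x, g x ^ 2 ∂unitMeasure = ∫ x, g x ^ 2 := fun {g} hg =>
    setIntegral_eq_integral_of_forall_compl_eq_zero fun x hx => by
      simp [hg x fun h => hx (h3 h)]
  simp only [mem_ofPred_eq, ← real_inner_self_eq_norm_sq, L2.inner_eq]
  have e1 : ∫ x, u x * u x ∂unitMeasure = ∫ x, φ x ^ 2 := by
    rw [← hs fun x => image_eq_zero_of_notMem_tsupport]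
    exact integral_congr_ae (by filter_upwards [hu] with x hx; rw [hx]; ring)
  have e2 : ∫ x, v x * v x ∂unitMeasure = ∫ x, deriv φ x ^ 2 := by
    rw [← hs fun x hx => by
      have : φ =ᶠ[𝓝 x] fun _ => 0 := notMem_tsupport_iff_eventuallyEq.1 hx
      simpa using this.deriv_eq]
    exact integral_congr_ae (by filter_upwards [hv] with x hx; rw [hx]; ring)
  rw [e1, e2]
  exact key

/-- The Dirichlet Laplacian on `(0, 1)` is bounded above by `-π²`. -/
theorem H2H10.inner_dxx_le (v : H2H10) :
    inner ℝ (H2H10.toL2 v) (H2H10.dxx v) ≤ -(Real.pi ^ 2 * ‖H2H10.toL2 v‖ ^ 2) := by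
  obtain ⟨⟨f, f', f''⟩, ⟨-, hq⟩, h2⟩ := v
  -- The pair (f', f'') is tested against (f, f') in H₀¹, which gives ⟨f'', f⟩ = -‖f'‖²; no boundary
  -- condition on f' is needed.
  have h := IsWeakDeriv.inner_eq_neg_inner h2 hq
  have hp := sq_pi_mul_norm_sq_le hq
  simp only [H2H10.toL2, H2H10.dxx] at *
  rw [real_inner_self_eq_norm_sq] at h
  rw [real_inner_comm]
  linarith

/-! ### Monotonicity and Grönwall for absolutely continuous functions. -/

/-- An absolutely continuous function with a.e. nonpositive derivative decreases. -/
theorem le_of_absolutelyContinuous_of_deriv_nonpos {f : ℝ → ℝ} {s t : ℝ} (hst : s ≤ t)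
    (hf : AbsolutelyContinuousOnInterval f s t)
    (h : ∀ᵐ x, x ∈ Ioo s t → ∃ f', HasDerivAt f f' x ∧ f' ≤ 0) : f t ≤ f s := by
  have e := hf.integral_deriv_eq_sub
  rw [intervalIntegral.integral_of_le hst, integral_Ioc_eq_integral_Ioo] at e
  have : ∫ x in Ioo s t, deriv f x ≤ 0 := by
    refine integral_nonpos_of_ae ((ae_restrict_iff' measurableSet_Ioo).2 ?_)
    filter_upwards [h] with x hx hxs
    obtain ⟨f', h1, h2⟩ := hx hxs
    simpa [h1.deriv] using h2
  linarith

/-- Truncation is 1-Lipschitz. This makes (V - ε)⁺ usable in a Lyapunov function although it is not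
differentiable everywhere. -/
theorem absolutelyContinuousOnInterval_max_zero {f : ℝ → ℝ} {s t : ℝ}
    (hf : AbsolutelyContinuousOnInterval f s t) :
    AbsolutelyContinuousOnInterval (fun x => max (f x) 0) s t := by
  refine squeeze_zero (fun E => Finset.sum_nonneg fun i _ => dist_nonneg) (fun E => ?_) hf
  refine Finset.sum_le_sum fun i _ => ?_
  simp only [Real.dist_eq]
  exact abs_max_sub_max_le_abs _ _ _

/-- A Grönwall inequality for absolutely continuous functions. -/
theorem gronwall_of_absolutelyContinuous {f : ℝ → ℝ} {s t k R : ℝ} (hk : k ≠ 0) (hst : s ≤ t)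
    (hf : AbsolutelyContinuousOnInterval f s t)
    (h : ∀ᵐ x, x ∈ Ioo s t → ∃ f', HasDerivAt f f' x ∧ f' ≤ -k * f x + R) :
    f t ≤ Real.exp (-k * (t - s)) * (f s - R / k) + R / k := by
  have hexp : AbsolutelyContinuousOnInterval (fun x => Real.exp (k * x)) s t :=
    ContDiffOn.absolutelyContinuousOnInterval (by fun_prop)
  have hcst : AbsolutelyContinuousOnInterval (fun _ : ℝ => R / k) s t :=
    ContDiffOn.absolutelyContinuousOnInterval (by fun_prop)
  -- The decreasing quantity is e^{kx}(f - R/k), where R/k is the equilibrium of the comparison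
  -- equation.
  have key := le_of_absolutelyContinuous_of_deriv_nonpos hst (hexp.mul (hf.sub hcst)) (by
    filter_upwards [h] with x hx hxs
    obtain ⟨f', h1, h2⟩ := hx hxs
    have he : HasDerivAt (fun x => Real.exp (k * x)) (Real.exp (k * x) * k) x := by
      simpa using ((hasDerivAt_id x).const_mul k).exp
    refine ⟨_, he.mul (h1.sub_const (R / k)), ?_⟩
    have : Real.exp (k * x) * k * (f x - R / k) + Real.exp (k * x) * f'
        = Real.exp (k * x) * (k * f x - R + f') := by field_simp
    simp only [Pi.sub_apply]
    rw [this]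
    exact mul_nonpos_of_nonneg_of_nonpos (Real.exp_pos _).le (by linarith))
  simp only [Pi.mul_apply, Pi.sub_apply] at key
  have e : Real.exp (-k * (t - s)) = Real.exp (k * s) / Real.exp (k * t) := by
    rw [← Real.exp_sub]; congr 1; ring
  rw [e, div_mul_eq_mul_div]
  have : f t - R / k ≤ Real.exp (k * s) * (f s - R / k) / Real.exp (k * t) := by
    rw [le_div_iff₀ (Real.exp_pos _)]; linarith
  linarith

/-- A Grönwall inequality on the half line, for functions that are only known to be continuous at
the initial time. -/
theorem gronwall_Ici {f : ℝ → ℝ} {k R : ℝ} (hk : k ≠ 0) (hc : ContinuousOn f (Ici 0))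
    (hf : ∀ s t, 0 < s → s ≤ t → AbsolutelyContinuousOnInterval f s t)
    (h : ∀ᵐ x, 0 < x → ∃ f', HasDerivAt f f' x ∧ f' ≤ -k * f x + R) {t : ℝ} (ht : 0 ≤ t) :
    f t ≤ Real.exp (-k * t) * (f 0 - R / k) + R / k := by
  rcases ht.eq_or_lt with rfl | ht
  · simp
  have lim : Tendsto (fun s => Real.exp (-k * (t - s)) * (f s - R / k) + R / k) (𝓝[>] 0)
      (𝓝 (Real.exp (-k * (t - 0)) * (f 0 - R / k) + R / k)) := by
    have h0 : Tendsto f (𝓝[>] 0) (𝓝 (f 0)) :=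
      (hc 0 self_mem_Ici).mono_left (nhdsWithin_mono _ Ioi_subset_Ici_self)
    have h1 : Tendsto (fun s => Real.exp (-k * (t - s))) (𝓝[>] 0)
        (𝓝 (Real.exp (-k * (t - 0)))) := by
      refine Tendsto.mono_left (Continuous.tendsto ?_ 0) nhdsWithin_le_nhds
      fun_prop
    exact (h1.mul (h0.sub_const _)).add_const _
  rw [sub_zero] at lim
  refine ge_of_tendsto lim ?_
  filter_upwards [Ioo_mem_nhdsGT ht] with s hs
  refine gronwall_of_absolutelyContinuous hk hs.2.le (hf s t hs.1 hs.2.le) ?_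
  filter_upwards [h] with x hx hxs using hx (hs.1.trans hxs.1)

/-! ### Boundedness of the gain and its consequence for the output. -/

/-- If `V` decays up to an error that is small when the gain `F` is large, while `F` grows only as
long as `V` exceeds `ε`, then `F` is bounded. -/
theorem gain_le {V F : ℝ → ℝ} {ε Γ k Q B : ℝ} (hε : 0 < ε) (hΓ : 0 ≤ Γ) (hk : 0 < k)
    (hV0 : ∀ t ≥ 0, 0 ≤ V t) (hVB : ∀ t ≥ 0, V t ≤ B)
    (hV : ∀ s t, 0 ≤ s → s ≤ t → AbsolutelyContinuousOnInterval V s t)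
    (hF : ContDiffOn ℝ 1 F (Ici 0)) (hFpos : ∀ t, 0 < F t)
    (hF' : ∀ t > 0, HasDerivAt F (Γ * max (V t - ε) 0) t)
    (hV' : ∀ᵐ t, 0 < t → ∃ V', HasDerivAt V V' t ∧ V' ≤ -k * V t + Q / F t)
    (hQ : 0 ≤ Q) {t : ℝ} (ht : 0 ≤ t) :
    F t ≤ F 0 + Q / (k * ε) + Γ / k * B := by
  have hFac : ∀ s t, 0 ≤ s → s ≤ t → AbsolutelyContinuousOnInterval F s t := fun s t hs hst =>
    ContDiffOn.absolutelyContinuousOnInterval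
      (hF.mono (by rw [uIcc_of_le hst]; exact fun x hx => hs.trans hx.1))
  have hB : 0 ≤ B := (hV0 t ht).trans (hVB t ht)
  have hGB : ∀ t ≥ 0, max (V t - ε) 0 ≤ B := fun t ht =>
    max_le (by linarith [hVB t ht]) hB
  have hFmono : ∀ s t, 0 ≤ s → s ≤ t → F s ≤ F t := by
    intro s t hs hst
    have := le_of_absolutelyContinuous_of_deriv_nonpos hst (hFac s t hs hst).neg
      (Eventually.of_forall fun x hx => ⟨_, (hF' x (hs.trans_lt hx.1)).neg, by
        have : 0 ≤ Γ * max (V x - ε) 0 := mul_nonneg hΓ (le_max_right _ _)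
        linarith⟩)
    simpa using this
  -- Above this threshold Q/F ≤ kε, so that V' ≤ -k(V - ε).
  set Th := Q / (k * ε) with hTh
  have hTh0 : 0 ≤ Th := by positivity
  have hΓB : 0 ≤ Γ / k * B := by positivity
  by_cases hle : F t ≤ F 0 + Th
  · linarith
  push Not at hle
  -- T is a time from which F stays above the threshold but at which it is still controlled: 0 if F
  -- starts above it, otherwise a crossing time.
  obtain ⟨T, hT0, hTt, hT1, hT2⟩ : ∃ T, 0 ≤ T ∧ T ≤ t ∧ Th ≤ F T ∧ F T ≤ F 0 + Th := by
    by_cases h0 : Th ≤ F 0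
    · exact ⟨0, le_rfl, ht, h0, by linarith⟩
    · push Not at h0
      obtain ⟨T, hT, hTF⟩ := intermediate_value_Icc ht
        (hF.continuousOn.mono Icc_subset_Ici_self) ⟨h0.le, by linarith [hFpos 0]⟩
      exact ⟨T, hT.1, hT.2, hTF.ge, by linarith [hFpos 0]⟩
  have hε' : AbsolutelyContinuousOnInterval (fun _ : ℝ => ε) T t :=
    ContDiffOn.absolutelyContinuousOnInterval (by fun_prop)
  have hGac := absolutelyContinuousOnInterval_max_zero ((hV T t hT0 hTt).sub hε')
  -- F + (Γ/k)(V - ε)⁺ is nonincreasing after T: the growth Γ(V - ε)⁺ of F is paid for by the decay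
  -- of (V - ε)⁺ at rate k.
  have hdec := le_of_absolutelyContinuous_of_deriv_nonpos hTt
    ((hFac T t hT0 hTt).add (hGac.const_mul (Γ / k))) (by
      filter_upwards [hV', hGac.ae_differentiableAt] with x hx hGd hxs
      have hx0 : 0 < x := hT0.trans_lt hxs.1
      have hGd' := (hGd (by rw [uIcc_of_le hTt]; exact ⟨hxs.1.le, hxs.2.le⟩)).hasDerivAt
      simp only [Pi.sub_apply] at hGd'
      refine ⟨_, (hF' x hx0).add (hGd'.const_mul (Γ / k)), ?_⟩
      suffices hG : deriv (fun x => max (V x - ε) 0) x ≤ -k * max (V x - ε) 0 by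
        have := mul_le_mul_of_nonneg_left hG (div_nonneg hΓ hk.le)
        have e : Γ / k * (-k * max (V x - ε) 0) = - (Γ * max (V x - ε) 0) := by field_simp
        linarith
      -- Where V ≤ ε the truncation attains its minimum, so its derivative is 0 with no information
      -- on V'.
      by_cases hVx : V x - ε ≤ 0
      · have h0 : max (V x - ε) 0 = 0 := max_eq_right hVx
        have hmin : IsLocalMin (fun x => max (V x - ε) 0) x :=
          Eventually.of_forall fun u => by simp only [h0]; exact le_max_right _ _
        rw [hmin.deriv_eq_zero, h0, mul_zero]
      · push Not at hVx
        obtain ⟨V', h1, h2⟩ := hx hx0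
        have hev : (fun x => max (V x - ε) 0) =ᶠ[𝓝 x] fun x => V x - ε := by
          filter_upwards [(h1.continuousAt.sub continuousAt_const).eventually (lt_mem_nhds hVx)]
            with u hu using max_eq_left (le_of_lt hu)
        rw [((h1.sub_const ε).congr_of_eventuallyEq hev).deriv, max_eq_left hVx.le]
        have hFx : Th ≤ F x := hT1.trans (hFmono T x hT0 hxs.1.le)
        have : Q / F x ≤ k * ε := by
          rw [div_le_iff₀ (hFpos x)]
          rw [hTh, div_le_iff₀ (by positivity)] at hFx
          linarith
        linarith)
  simp only [Pi.add_apply, Pi.sub_apply] at hdec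
  have g1 : 0 ≤ Γ / k * max (V t - ε) 0 := by positivity
  have g2 : Γ / k * max (V T - ε) 0 ≤ Γ / k * B :=
    mul_le_mul_of_nonneg_left (hGB T hT0) (by positivity)
  linarith

/-- A one-sided Barbălat lemma. -/
theorem eventually_le_of_bounded_gain {V F : ℝ → ℝ} {ε Γ Q B : ℝ} (hΓ : 0 < Γ)
    (hV : ∀ s t, 0 ≤ s → s ≤ t → AbsolutelyContinuousOnInterval V s t)
    (hF : ContDiffOn ℝ 1 F (Ici 0)) (hFB : ∀ t ≥ 0, F t ≤ B)
    (hF' : ∀ t > 0, HasDerivAt F (Γ * max (V t - ε) 0) t)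
    (hV' : ∀ᵐ t, 0 < t → ∃ V', HasDerivAt V V' t ∧ V' ≤ Q) {δ : ℝ} (hδ : 0 < δ) :
    ∀ᶠ t in atTop, V t ≤ ε + δ := by
  have hFac : ∀ s t, 0 ≤ s → s ≤ t → AbsolutelyContinuousOnInterval F s t := fun s t hs hst =>
    ContDiffOn.absolutelyContinuousOnInterval
      (hF.mono (by rw [uIcc_of_le hst]; exact fun x hx => hs.trans hx.1))
  have hFmono : ∀ s t, 0 ≤ s → s ≤ t → F s ≤ F t := by
    intro s t hs hst
    have := le_of_absolutelyContinuous_of_deriv_nonpos hst (hFac s t hs hst).neg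
      (Eventually.of_forall fun x hx => ⟨_, (hF' x (hs.trans_lt hx.1)).neg, by
        have : 0 ≤ Γ * max (V x - ε) 0 := mul_nonneg hΓ.le (le_max_right _ _)
        linarith⟩)
    simpa using this
  -- In a time h, V climbs by at most δ/2. Exceeding ε + δ at time t thus means V ≥ ε + δ/2 on [t -
  -- h, t], and F gains at least η there, more than remains below its supremum.
  set h := δ / (2 * (|Q| + 1)) with hh
  have hh0 : 0 < h := by positivity
  have hQh : |Q| * h ≤ δ / 2 := by
    rw [hh, mul_div_assoc', div_le_div_iff₀ (by positivity) (by norm_num)]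
    nlinarith [abs_nonneg Q]
  set η := Γ * (δ / 2) * h with hη
  have hη0 : 0 < η := by positivity
  set s := F '' Ici 0 with hs
  have hbdd : BddAbove s := ⟨B, by rintro _ ⟨t, ht, rfl⟩; exact hFB t ht⟩
  obtain ⟨_, ⟨T, hT, rfl⟩, hTF⟩ := exists_lt_of_lt_csSup (s := s) ⟨F 0, 0, self_mem_Ici, rfl⟩
    (sub_lt_self (sSup s) hη0)
  have hT : 0 ≤ T := hT
  filter_upwards [eventually_ge_atTop (T + h)] with t ht
  by_contra! hVt
  have ht0 : 0 ≤ t - h := by linarith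
  have hlow : ∀ x, t - h ≤ x → x ≤ t → ε + δ / 2 ≤ V x := by
    intro x hx1 hx2
    have hlin : AbsolutelyContinuousOnInterval (fun x : ℝ => Q * x) x t :=
      ContDiffOn.absolutelyContinuousOnInterval (by fun_prop)
    have := le_of_absolutelyContinuous_of_deriv_nonpos hx2
      ((hV x t (ht0.trans hx1) hx2).sub hlin) (by
        filter_upwards [hV'] with u hu hux
        obtain ⟨V', h1, h2⟩ := hu ((ht0.trans hx1).trans_lt hux.1)
        refine ⟨_, h1.sub ((hasDerivAt_id u).const_mul Q), ?_⟩
        linarith)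
    simp only [Pi.sub_apply] at this
    have : Q * (t - x) ≤ |Q| * h :=
      mul_le_mul (le_abs_self _) (by linarith) (by linarith) (abs_nonneg _)
    linarith
  have hlin : AbsolutelyContinuousOnInterval (fun x : ℝ => Γ * (δ / 2) * x) (t - h) t :=
    ContDiffOn.absolutelyContinuousOnInterval (by fun_prop)
  have := le_of_absolutelyContinuous_of_deriv_nonpos (by linarith)
    (hlin.sub (hFac (t - h) t ht0 (by linarith))) (Eventually.of_forall fun u hu =>
      ⟨_, ((hasDerivAt_id u).const_mul (Γ * (δ / 2))).sub (hF' u (ht0.trans_lt hu.1)), by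
        have h1 := hlow u hu.1.le hu.2.le
        have : Γ * (δ / 2) ≤ Γ * max (V u - ε) 0 :=
          mul_le_mul_of_nonneg_left (le_max_of_le_left (by linarith)) hΓ.le
        linarith⟩)
  simp only [Pi.sub_apply] at this
  have h1 : F t ≤ sSup s := le_csSup hbdd ⟨t, by simp only [mem_Ici]; linarith, rfl⟩
  have h2 := hFmono T (t - h) hT (by linarith)
  have : Γ * (δ / 2) * t - Γ * (δ / 2) * (t - h) = η := by rw [hη]; ring
  linarith

/-! ### Pointwise dissipation inequalities, by Young's inequality. -/

/-- The dissipation inequality for `‖w‖² + y²`. -/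
theorem energy_dissipation {P k c β M X Y s₁ s₂ D Θ : ℝ} (hP : 0 < P) (hkP : k ≤ P / 2)
    (hkc : k ≤ 2 * c) (hc : 1 ≤ c) (hβ : 0 < β) (hM : 1 / (4 * β) ≤ M)
    (hs : s₁ ^ 2 + s₂ ^ 2 ≤ Θ ^ 2) :
    -2 * P * X ^ 2 + 2 * s₁ * Y * X +
      2 * (-c * (1 + M) * (Y ^ 8 + Y ^ 4 + Y ^ 2) + s₂ * X * Y + D * Y)
      ≤ -k * (X ^ 2 + Y ^ 2) + (2 * β * D ^ 2 + Θ ^ 4 / (2 * P ^ 2)) := by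
  have hM0 : 0 ≤ M := le_trans (by positivity) hM
  -- The weight 3/2 leaves P/2 of the dissipation 2P, exactly what k ≤ P/2 requires. The remaining
  -- Y² term is traded below for 8/9·Y⁴, which the cubic feedback absorbs since 8/9 < 2c.
  have h1 : 2 * (s₁ + s₂) * X * Y ≤ 3 / 2 * P * X ^ 2 + 4 / 3 * (Θ ^ 2 / P) * Y ^ 2 := by
    have e : 3 / 2 * P * X ^ 2 + 4 / 3 * (Θ ^ 2 / P) * Y ^ 2
        = (9 / 4 * (P * X) ^ 2 + 2 * Θ ^ 2 * Y ^ 2) / (3 / 2 * P) := by field_simp; ring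
    rw [e, le_div_iff₀ (by positivity)]
    have h3 : (s₁ + s₂) ^ 2 * Y ^ 2 ≤ 2 * Θ ^ 2 * Y ^ 2 :=
      mul_le_mul_of_nonneg_right (by nlinarith [sq_nonneg (s₁ - s₂)]) (sq_nonneg _)
    nlinarith [sq_nonneg (3 / 2 * (P * X) - (s₁ + s₂) * Y)]
  have h2 : 4 / 3 * (Θ ^ 2 / P) * Y ^ 2 ≤ Θ ^ 4 / (2 * P ^ 2) + 8 / 9 * Y ^ 4 := by
    have e : Θ ^ 4 / (2 * P ^ 2) = (Θ ^ 2 / P) ^ 2 / 2 := by field_simp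
    rw [e]
    nlinarith [sq_nonneg (Θ ^ 2 / P - 4 / 3 * Y ^ 2)]
  have h4 : 2 * (D * Y) ≤ 2 * β * D ^ 2 + 2 * M * Y ^ 2 := by
    have h5 : 1 / (4 * β) * Y ^ 2 ≤ M * Y ^ 2 := mul_le_mul_of_nonneg_right hM (sq_nonneg _)
    have h6 : D * Y ≤ β * D ^ 2 + 1 / (4 * β) * Y ^ 2 := by
      have e : β * D ^ 2 + 1 / (4 * β) * Y ^ 2 = (4 * (β * D) ^ 2 + Y ^ 2) / (4 * β) := by
        field_simp
      rw [e, le_div_iff₀ (by positivity)]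
      nlinarith [sq_nonneg (2 * (β * D) - Y)]
    linarith
  have h7 : M * (Y ^ 8 + Y ^ 4 + Y ^ 2) ≤ c * (M * (Y ^ 8 + Y ^ 4 + Y ^ 2)) :=
    le_mul_of_one_le_left (by positivity) hc
  have h8 : Y ^ 8 + Y ^ 4 ≤ c * (Y ^ 8 + Y ^ 4) := le_mul_of_one_le_left (by positivity) hc
  have h9 : 0 ≤ M * Y ^ 8 := by positivity
  have h10 : 0 ≤ M * Y ^ 4 := by positivity
  have h11 : 0 ≤ Y ^ 8 := by positivity
  have h12 : 0 ≤ Y ^ 4 := by positivity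
  have h13 : k * X ^ 2 ≤ P / 2 * X ^ 2 := mul_le_mul_of_nonneg_right hkP (sq_nonneg _)
  have h14 : k * Y ^ 2 ≤ 2 * c * Y ^ 2 := mul_le_mul_of_nonneg_right hkc (sq_nonneg _)
  nlinarith

/-- The dissipation inequality for `y² / 2`, with the effect of the disturbances attenuated by the
gain `r`. -/
theorem output_dissipation {P c M r X Y s D Θ N : ℝ} (hP : 0 < P) (hc : 1 ≤ c) (hr : 0 < r)
    (hM : r / 4 ≤ M) (hM' : r ^ 3 / 4 ≤ M) (hX : 0 ≤ X) (hY : 0 ≤ Y) (hs : s ≤ Θ)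
    (hN : D ^ 2 + P / 2 * X ^ 2 + Θ ^ 4 / (4 * P ^ 2) ≤ N) :
    -c * (1 + M) * (Y ^ 8 + Y ^ 4 + Y ^ 2) + s * X * Y + D * Y ≤ -c * Y ^ 2 + N / r := by
  have hM0 : 0 ≤ M := le_trans (by positivity) hM
  have h1 : D * Y ≤ D ^ 2 / r + r / 4 * Y ^ 2 := by
    have e : D ^ 2 / r + r / 4 * Y ^ 2 = (4 * D ^ 2 + (r * Y) ^ 2) / (4 * r) := by field_simp
    rw [e, le_div_iff₀ (by positivity)]
    nlinarith [sq_nonneg (2 * D - r * Y)]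
  have h2 : s * X * Y ≤ P / 2 * X ^ 2 / r + r * (Θ ^ 2 / P) * Y ^ 2 / 2 := by
    have e : P / 2 * X ^ 2 / r + r * (Θ ^ 2 / P) * Y ^ 2 / 2
        = ((P * X) ^ 2 + (r * Θ * Y) ^ 2) / (2 * P * r) := by field_simp
    have h : s * X * Y ≤ Θ * X * Y := by gcongr
    refine h.trans ?_
    rw [e, le_div_iff₀ (by positivity)]
    nlinarith [sq_nonneg (P * X - r * Θ * Y)]
  have h3 : r * (Θ ^ 2 / P) * Y ^ 2 / 2 ≤ Θ ^ 4 / (4 * P ^ 2) / r + r ^ 3 / 4 * Y ^ 4 := by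
    have e : Θ ^ 4 / (4 * P ^ 2) / r + r ^ 3 / 4 * Y ^ 4
        = ((Θ ^ 2 / P) ^ 2 + (r ^ 2 * Y ^ 2) ^ 2) / (4 * r) := by field_simp
    rw [e, le_div_iff₀ (by positivity)]
    nlinarith [sq_nonneg (Θ ^ 2 / P - r ^ 2 * Y ^ 2)]
  have h4 : (D ^ 2 + P / 2 * X ^ 2 + Θ ^ 4 / (4 * P ^ 2)) / r ≤ N / r := by gcongr
  rw [add_div, add_div] at h4
  have h5 : r / 4 * Y ^ 2 ≤ M * Y ^ 2 := mul_le_mul_of_nonneg_right hM (sq_nonneg _)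
  have h6 : r ^ 3 / 4 * Y ^ 4 ≤ M * Y ^ 4 := mul_le_mul_of_nonneg_right hM' (by positivity)
  have h7 : M * (Y ^ 8 + Y ^ 4 + Y ^ 2) ≤ c * (M * (Y ^ 8 + Y ^ 4 + Y ^ 2)) :=
    le_mul_of_one_le_left (by positivity) hc
  have h8 : 0 ≤ c * (Y ^ 8 + Y ^ 4) := by positivity
  have h9 : 0 ≤ M * Y ^ 8 := by positivity
  nlinarith

/-! ### The constants κ, K̄ and B̄. -/

theorem kappa_pos {p c : ℝ} (hp : 0 < p) (hc : 1 ≤ c) : 0 < kappa p c :=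
  lt_min (by positivity) (by positivity)

/-- With P = pπ², the last three summands are the coefficients that arise when the energy bound is
multiplied by P/2; the 1 takes the direct contribution of d. -/
theorem Kbar_eq {a b c p : ℝ} (hb : 1 ≤ b) (hp : 0 < p) (hc : 1 ≤ c) :
    Kbar a b c p = 1 + p * Real.pi ^ 2 / 2 + a * (p * Real.pi ^ 2) / (b * kappa p c)
      + 1 / (4 * (p * Real.pi ^ 2) * kappa p c) := by
  have := kappa_pos hp hc
  have hπ := Real.pi_pos
  unfold Kbar
  field_simp
  ring

theorem Kbar_pos {a b c p : ℝ} (ha : 0 < a) (hb : 1 ≤ b) (hp : 0 < p) (hc : 1 ≤ c) :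
    0 < Kbar a b c p := by
  have := kappa_pos hp hc
  rw [Kbar_eq hb hp hc]
  positivity

/-- The right side is what `gain_le` yields with k = 2c, Q = aK̄S and B = S/2 + Q/(2c). -/
theorem Bbar_mul {ε Γ a b c p S : ℝ} (hε : 0 < ε) (hc : 1 ≤ c) :
    Bbar ε Γ a b c p * S = a * Kbar a b c p * S / (2 * c * ε)
      + Γ / (2 * c) * (S / 2 + a * Kbar a b c p * S / (2 * c)) := by
  unfold Bbar
  have : c ≠ 0 := by positivity
  field_simp
  ring

/-- The total disturbance seen by the output equation is at most `K̄` times the size of the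
data. -/
theorem disturbance_le {a b c p D Θ E₀ X : ℝ} (ha : 0 < a) (hb : 1 ≤ b) (hp : 0 < p) (hc : 1 ≤ c)
    (hE₀ : 0 ≤ E₀)
    (hX : X ^ 2 ≤ E₀ + 2 * a * ((D ^ 2 + Θ ^ 8 + 2 * (p ^ 2)⁻¹) / (b * kappa p c))
      + Θ ^ 4 / (2 * p ^ 2 * Real.pi ^ 4 * kappa p c)) :
    D ^ 2 + p * Real.pi ^ 2 / 2 * X ^ 2 + Θ ^ 4 / (4 * (p * Real.pi ^ 2) ^ 2)
      ≤ Kbar a b c p * (D ^ 2 + Θ ^ 4 + Θ ^ 8 + 2 * (p ^ 2)⁻¹ + E₀) := by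
  have hk := kappa_pos hp hc
  have hkP : kappa p c ≤ p * Real.pi ^ 2 / 2 := min_le_left _ _
  rw [Kbar_eq hb hp hc]
  generalize kappa p c = k at *
  have hπ := Real.pi_pos
  have hinv : 2 * (p ^ 2)⁻¹ = 2 * Real.pi ^ 4 / (p * Real.pi ^ 2) ^ 2 := by field_simp
  have hden : 2 * p ^ 2 * Real.pi ^ 4 * k = 2 * (p * Real.pi ^ 2) ^ 2 * k := by ring
  rw [hinv, hden] at hX
  rw [hinv]
  have hP : 0 < p * Real.pi ^ 2 := by positivity
  have hπ1 : 1 ≤ Real.pi ^ 4 := one_le_pow₀ (by linarith [Real.pi_gt_three])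
  generalize p * Real.pi ^ 2 = P at *
  generalize Real.pi ^ 4 = ϖ at *
  set T := D ^ 2 + Θ ^ 8 + 2 * ϖ / P ^ 2 with hT
  have hT0 : 0 ≤ T := by positivity
  have e1 : P / 2 * (E₀ + 2 * a * (T / (b * k)) + Θ ^ 4 / (2 * P ^ 2 * k))
      = P / 2 * E₀ + a * P / (b * k) * T + 1 / (4 * P * k) * Θ ^ 4 := by
    field_simp
    ring
  have h1 := mul_le_mul_of_nonneg_left hX (by positivity : 0 ≤ P / 2)
  rw [e1] at h1
  have h2 : 1 / (2 * P ^ 2) ≤ 1 / (4 * P * k) :=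
    one_div_le_one_div_of_le (by positivity) (by nlinarith)
  have h3 : 1 / (2 * P ^ 2) * Θ ^ 8 ≤ 1 / (4 * P * k) * Θ ^ 8 :=
    mul_le_mul_of_nonneg_right h2 (by positivity)
  -- The Θ⁴ part of K̄S with coefficient 1/(4Pk) is already used up by X², so this term is charged
  -- to Θ⁸ and to 2p⁻² = 2ϖ/P².
  have h4 : Θ ^ 4 / (4 * P ^ 2) ≤ 1 / (2 * P ^ 2) * Θ ^ 8 + 2 * ϖ / P ^ 2 := by
    have e : 1 / (2 * P ^ 2) * Θ ^ 8 + 2 * ϖ / P ^ 2 = (2 * Θ ^ 8 + 8 * ϖ) / (4 * P ^ 2) := by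
      field_simp
      ring
    rw [e]
    gcongr
    nlinarith [sq_nonneg (Θ ^ 4 - 1)]
  have e2 : D ^ 2 + Θ ^ 4 + Θ ^ 8 + 2 * ϖ / P ^ 2 + E₀ = T + Θ ^ 4 + E₀ := by rw [hT]; ring
  rw [e2]
  have p1 : 0 ≤ P / 2 * (T + Θ ^ 4) := by positivity
  have p2 : 0 ≤ a * P / (b * k) * (Θ ^ 4 + E₀) := by positivity
  have p3 : 0 ≤ 1 / (4 * P * k) * (D ^ 2 + 2 * ϖ / P ^ 2 + E₀) := by positivity
  have p4 : 0 ≤ Θ ^ 8 := by positivity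
  have p5 : 0 ≤ Θ ^ 4 := by positivity
  have e3 : T = D ^ 2 + Θ ^ 8 + 2 * ϖ / P ^ 2 := hT
  have e4 : (1 + P / 2 + a * P / (b * k) + 1 / (4 * P * k)) * (T + Θ ^ 4 + E₀)
      = (T + Θ ^ 4 + E₀) + (P / 2 * (T + Θ ^ 4) + P / 2 * E₀)
        + (a * P / (b * k) * T + a * P / (b * k) * (Θ ^ 4 + E₀))
        + (1 / (4 * P * k) * Θ ^ 4 + 1 / (4 * P * k) * Θ ^ 8
          + 1 / (4 * P * k) * (D ^ 2 + 2 * ϖ / P ^ 2 + E₀)) := by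
    rw [hT]; ring
  rw [e4]
  linarith

/-! ### Essential bounds. -/

theorem ae_norm_le_supNorm {E : Type*} [NormedAddCommGroup E] {f : ℝ → E}
    (hf : MemLp f ∞ (volume.restrict (Ici (0 : ℝ)))) :
    ∀ᵐ t, 0 ≤ t → ‖f t‖ ≤ supNorm f := by
  have h := (ae_restrict_iff' measurableSet_Ici).1
    (ae_le_eLpNormEssSup (f := f) (μ := volume.restrict (Ici (0 : ℝ))))
  filter_upwards [h] with t ht h0
  have := ht h0
  rw [← eLpNorm_exponent_top] at this
  rw [supNorm, ← toReal_enorm]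
  exact ENNReal.toReal_mono hf.2.ne this

/-- The essential bound of a continuous function holds everywhere. -/
theorem norm_le_supNorm {E : Type*} [NormedAddCommGroup E] {f : ℝ → E}
    (hf : MemLp f ∞ (volume.restrict (Ici (0 : ℝ)))) (hc : ContinuousOn f (Ici 0)) {t : ℝ}
    (ht : 0 < t) : ‖f t‖ ≤ supNorm f := by
  by_contra! hlt
  have hat : ContinuousAt f t := hc.continuousAt (Ici_mem_nhds ht)
  have hev : ∀ᶠ s in 𝓝 t, supNorm f < ‖f s‖ ∧ 0 < s :=
    (hat.norm.eventually (lt_mem_nhds hlt)).and (lt_mem_nhds ht)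
  have hpos : 0 < volume {s | supNorm f < ‖f s‖ ∧ 0 < s} := Measure.measure_pos_of_mem_nhds _ hev
  refine hpos.ne' (measure_mono_null ?_ (ae_iff.1 (ae_norm_le_supNorm hf)))
  rintro s ⟨h1, h2⟩ h3
  exact absurd (h3 h2.le) (not_le.2 h1)

/-! ### Estimates along a solution. -/

section Solution

variable {ε Γ a b c p : ℝ} {K : ℝ → ℝ → ℝ} {L : H2H10 → ℝ} {d : ℝ → ℝ}
  {θ : ℝ → EuclideanSpace ℝ (Fin 2)} {w : ℝ → L2} {W : ℝ → H2H10} {y z : ℝ → ℝ}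

theorem IsSolution.hasDerivAt_w (h : IsSolution ε Γ a b c p K L d θ w W y z) {t : ℝ} (ht : 0 < t) :
    HasDerivAt w (deriv w t) t :=
  ((h.w_contDiff.differentiableOn (by norm_num)).differentiableAt (Ioi_mem_nhds ht)).hasDerivAt

/-- The energy inequality for the heat equation. -/
theorem IsSolution.hasDerivAt_norm_sq_le (h : IsSolution ε Γ a b c p K L d θ w W y z)
    (hp : 0 < p) (hK : ∀ x ∈ Icc (0 : ℝ) 1, ∀ y : ℝ, |K x y| ≤ |y|) {t : ℝ} (ht : 0 < t) :
    ∃ f', HasDerivAt (fun t => ‖w t‖ ^ 2) f' t ∧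
      f' ≤ -2 * (p * Real.pi ^ 2) * ‖w t‖ ^ 2 + 2 * |θ t 0| * |y t| * ‖w t‖ := by
  refine ⟨_, (h.hasDerivAt_w ht).norm_sq, ?_⟩
  -- The reaction term is recovered as a difference of L² elements, so no measurability of K(·,
  -- y(t)) has to be assumed.
  set g : L2 := deriv w t - p • H2H10.dxx (W t) with hg
  have hgn : ‖g‖ ≤ |θ t 0| * |y t| := by
    have := Lp.norm_le_of_ae_bound (f := g) (C := |θ t 0| * |y t|) (by positivity) (by
      have hmem : ∀ᵐ x ∂unitMeasure, x ∈ Ioo (0 : ℝ) 1 := ae_restrict_mem measurableSet_Ioo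
      filter_upwards [h.w_eqn t ht, Lp.coeFn_sub (deriv w t) (p • H2H10.dxx (W t)),
        Lp.coeFn_smul p (H2H10.dxx (W t)), hmem] with x h1 h2 h3 h4
      rw [hg, h2, Pi.sub_apply, h1, h3, Pi.smul_apply, smul_eq_mul, add_sub_cancel_left,
        norm_mul, Real.norm_eq_abs, Real.norm_eq_abs]
      exact mul_le_mul_of_nonneg_left (hK x ⟨h4.1.le, h4.2.le⟩ _) (abs_nonneg _))
    simpa [measureUnivNNReal] using this
  have hd : deriv w t = p • H2H10.dxx (W t) + g := by rw [hg]; abel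
  have h1 := H2H10.inner_dxx_le (W t)
  rw [h.W_eq t ht] at h1
  have h2 : inner ℝ (w t) g ≤ ‖w t‖ * (|θ t 0| * |y t|) :=
    (real_inner_le_norm _ _).trans (mul_le_mul_of_nonneg_left hgn (norm_nonneg _))
  rw [hd, inner_add_right, real_inner_smul_right]
  have h3 := mul_le_mul_of_nonneg_left h1 hp.le
  linarith

theorem IsSolution.absolutelyContinuous_norm_sq (h : IsSolution ε Γ a b c p K L d θ w W y z)
    {s t : ℝ} (hs : 0 < s) (hst : s ≤ t) :
    AbsolutelyContinuousOnInterval (fun t => ‖w t‖ ^ 2) s t := by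
  refine ContDiffOn.absolutelyContinuousOnInterval ((h.w_contDiff.mono ?_).norm_sq ℝ)
  rw [uIcc_of_le hst]
  exact fun x hx => hs.trans_le hx.1

theorem IsSolution.absolutelyContinuous_y_sq (h : IsSolution ε Γ a b c p K L d θ w W y z)
    {s t : ℝ} (hs : 0 ≤ s) (hst : s ≤ t) :
    AbsolutelyContinuousOnInterval (fun t => y t ^ 2) s t := by
  have e : (fun t => y t ^ 2) = y * y := by funext t; simp [sq]
  rw [e]
  exact (h.y_absCont s t hs hst).mul (h.y_absCont s t hs hst)

/-- The derivative of `y² / 2` along a solution. -/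
theorem IsSolution.ae_hasDerivAt_y_sq_le (h : IsSolution ε Γ a b c p K L d θ w W y z)
    (hL : ∀ v : H2H10, |L v| ≤ ‖H2H10.toL2 v‖) (hd : MemLp d ∞ (volume.restrict (Ici (0 : ℝ)))) :
    ∀ᵐ t, 0 < t → ∃ f', HasDerivAt (fun t => y t ^ 2 / 2) f' t ∧
      f' ≤ -c * (1 + (b + Real.exp (z t)) ^ 7 / (4 * a ^ 6)) * (|y t| ^ 8 + |y t| ^ 4 + |y t| ^ 2)
        + |θ t 1| * ‖w t‖ * |y t| + supNorm d * |y t| := by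
  filter_upwards [(ae_restrict_iff' measurableSet_Ioi).1 h.y_eqn, ae_norm_le_supNorm hd]
    with t h1 h2 ht
  have h1 := h1 ht
  have h2 := h2 ht.le
  have h3 : |L (W t)| ≤ ‖w t‖ := by rw [← h.W_eq t ht]; exact hL _
  refine ⟨_, (h1.pow 2).div_const 2, ?_⟩
  have e1 : |y t| ^ 8 = y t ^ 8 := by rw [show 8 = 2 * 4 from rfl, pow_mul, sq_abs, ← pow_mul]
  have e2 : |y t| ^ 4 = y t ^ 4 := by rw [show 4 = 2 * 2 from rfl, pow_mul, sq_abs, ← pow_mul]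
  rw [e1, e2, sq_abs]
  have h4 : y t * (θ t 1 * L (W t)) ≤ |θ t 1| * ‖w t‖ * |y t| := by
    refine (le_abs_self _).trans ?_
    rw [abs_mul, abs_mul, mul_comm]
    gcongr
  have h5 : y t * d t ≤ supNorm d * |y t| := by
    refine (le_abs_self _).trans ?_
    rw [abs_mul, mul_comm]
    gcongr
    exact h2
  unfold feedback
  norm_num
  generalize (b + Real.exp (z t)) ^ 7 / (4 * a ^ 6) = M at *
  nlinarith

theorem abs_apply_le_norm (v : EuclideanSpace ℝ (Fin 2)) (i : Fin 2) : |v i| ≤ ‖v‖ :=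
  PiLp.norm_apply_le v i

/-- Separates the Grönwall equilibrium R/k from the T part of the stated bound, which is nonnegative
slack when T = Θ⁸ + 2p⁻². -/
theorem rate_div_eq {p a b k D T Θ : ℝ} (hp : 0 < p) (hb : 0 < b) (hk : 0 < k) :
    2 * a * ((D ^ 2 + T) / (b * k)) + Θ ^ 4 / (2 * p ^ 2 * Real.pi ^ 4 * k)
      = (2 * (a / b) * D ^ 2 + Θ ^ 4 / (2 * (p * Real.pi ^ 2) ^ 2)) / k
        + 2 * a * (T / (b * k)) := by
  have := Real.pi_pos
  field_simp
  ring

/-- The energy inequality for the whole plant. -/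
theorem IsSolution.ae_hasDerivAt_energy_le (h : IsSolution ε Γ a b c p K L d θ w W y z)
    (hc : 1 ≤ c) (hb : 1 ≤ b) (ha : 0 < a) (ha1 : a ≤ 1) (hp : 0 < p)
    (hK : ∀ x ∈ Icc (0 : ℝ) 1, ∀ y : ℝ, |K x y| ≤ |y|) (hL : ∀ v : H2H10, |L v| ≤ ‖H2H10.toL2 v‖)
    (hd : MemLp d ∞ (volume.restrict (Ici (0 : ℝ)))) (hθc : ContinuousOn θ (Ici 0))
    (hθ : MemLp θ ∞ (volume.restrict (Ici (0 : ℝ)))) :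
    ∀ᵐ t, 0 < t → ∃ f', HasDerivAt (fun t => ‖w t‖ ^ 2 + y t ^ 2) f' t ∧
      f' ≤ -kappa p c * (‖w t‖ ^ 2 + y t ^ 2) +
        (2 * (a / b) * supNorm d ^ 2 + supNorm θ ^ 4 / (2 * (p * Real.pi ^ 2) ^ 2)) := by
  have hP : 0 < p * Real.pi ^ 2 := by have := Real.pi_pos; positivity
  filter_upwards [h.ae_hasDerivAt_y_sq_le hL hd] with t h1 ht
  obtain ⟨f₁, d1, l1⟩ := h.hasDerivAt_norm_sq_le hp hK ht
  obtain ⟨f₂, d2, l2⟩ := h1 ht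
  have d3 : HasDerivAt (fun t => y t ^ 2) (2 * f₂) t := by
    convert! d2.const_mul 2 using 1
    funext u; ring
  refine ⟨_, d1.add d3, ?_⟩
  have hq : 1 ≤ b + Real.exp (z t) := by linarith [Real.exp_pos (z t)]
  -- β = a/b is the Young weight on d. It is admissible for every z because the gain is at least
  -- b/(4a).
  have hM : 1 / (4 * (a / b)) ≤ (b + Real.exp (z t)) ^ 7 / (4 * a ^ 6) := by
    have e : 1 / (4 * (a / b)) = b / (4 * a) := by field_simp
    rw [e]
    have h7 : b ≤ (b + Real.exp (z t)) ^ 7 :=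
      le_trans (by linarith [Real.exp_pos (z t)]) (le_self_pow₀ hq (by norm_num))
    have h6 : a ^ 6 ≤ a := pow_le_of_le_one ha.le ha1 (by norm_num)
    gcongr
  have hs : |θ t 0| ^ 2 + |θ t 1| ^ 2 ≤ supNorm θ ^ 2 := by
    have e : ‖θ t‖ ^ 2 = |θ t 0| ^ 2 + |θ t 1| ^ 2 := by
      rw [EuclideanSpace.norm_sq_eq]; simp
    rw [← e]
    exact pow_le_pow_left₀ (norm_nonneg _) (norm_le_supNorm hθ hθc ht) 2
  have := energy_dissipation (X := ‖w t‖) (Y := |y t|) (D := supNorm d) (k := kappa p c) hP (min_le_left _ _)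
    (min_le_right _ _) hc (by positivity) hM hs
  rw [sq_abs (y t)] at this l2
  linarith

/-- The bound on the state of the plant. -/
theorem IsSolution.energy_le (h : IsSolution ε Γ a b c p K L d θ w W y z)
    (hc : 1 ≤ c) (hb : 1 ≤ b) (ha : 0 < a) (ha1 : a ≤ 1) (hp : 0 < p)
    (hK : ∀ x ∈ Icc (0 : ℝ) 1, ∀ y : ℝ, |K x y| ≤ |y|) (hL : ∀ v : H2H10, |L v| ≤ ‖H2H10.toL2 v‖)
    (hd : MemLp d ∞ (volume.restrict (Ici (0 : ℝ)))) (hθc : ContinuousOn θ (Ici 0))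
    (hθ : MemLp θ ∞ (volume.restrict (Ici (0 : ℝ)))) {t : ℝ} (ht : 0 ≤ t) :
    ‖w t‖ ^ 2 + y t ^ 2 ≤ Real.exp (-kappa p c * t) * (‖w 0‖ ^ 2 + y 0 ^ 2)
        + 2 * a * ((supNorm d ^ 2 + supNorm θ ^ 8 + 2 * (p ^ 2)⁻¹) / (b * kappa p c))
        + supNorm θ ^ 4 / (2 * p ^ 2 * Real.pi ^ 4 * kappa p c) := by
  have hk := kappa_pos hp hc
  set R := 2 * (a / b) * supNorm d ^ 2 + supNorm θ ^ 4 / (2 * (p * Real.pi ^ 2) ^ 2)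
  have hR0 : 0 ≤ R := by positivity
  have hcont : ContinuousOn (fun t => ‖w t‖ ^ 2 + y t ^ 2) (Ici 0) :=
    (h.w_continuous.norm.pow 2).add (h.y_continuous.pow 2)
  have hac : ∀ s t, 0 < s → s ≤ t →
      AbsolutelyContinuousOnInterval (fun t => ‖w t‖ ^ 2 + y t ^ 2) s t := fun s t hs hst =>
    (h.absolutelyContinuous_norm_sq hs hst).fun_add (h.absolutelyContinuous_y_sq hs.le hst)
  have key := gronwall_Ici hk.ne' hcont hac
    (h.ae_hasDerivAt_energy_le hc hb ha ha1 hp hK hL hd hθc hθ) ht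
  refine key.trans ?_
  rw [add_assoc (supNorm d ^ 2), add_assoc, rate_div_eq hp (by positivity) hk]
  have e2 : 0 ≤ 2 * a * ((supNorm θ ^ 8 + 2 * (p ^ 2)⁻¹) / (b * kappa p c)) := by positivity
  have e3 : 0 ≤ Real.exp (-kappa p c * t) * (R / kappa p c) := by positivity
  rw [mul_sub]
  linarith

/-- `output_dissipation` is used with r = (b + e^z)/a ≥ 1; the powers 7 and 6 in the gain make it
dominate r³/4. The energy bound turns ‖w‖ into data. -/
theorem IsSolution.ae_hasDerivAt_y_sq_le_attenuated
    (h : IsSolution ε Γ a b c p K L d θ w W y z)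
    (hc : 1 ≤ c) (hb : 1 ≤ b) (ha : 0 < a) (ha1 : a ≤ 1) (hp : 0 < p)
    (hK : ∀ x ∈ Icc (0 : ℝ) 1, ∀ y : ℝ, |K x y| ≤ |y|) (hL : ∀ v : H2H10, |L v| ≤ ‖H2H10.toL2 v‖)
    (hd : MemLp d ∞ (volume.restrict (Ici (0 : ℝ)))) (hθc : ContinuousOn θ (Ici 0))
    (hθ : MemLp θ ∞ (volume.restrict (Ici (0 : ℝ)))) :
    ∀ᵐ t, 0 < t → ∃ f', HasDerivAt (fun t => y t ^ 2 / 2) f' t ∧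
      f' ≤ -(2 * c) * (y t ^ 2 / 2) + a * Kbar a b c p *
        (supNorm d ^ 2 + supNorm θ ^ 4 + supNorm θ ^ 8 + 2 * (p ^ 2)⁻¹ + (‖w 0‖ ^ 2 + y 0 ^ 2))
          / (b + Real.exp (z t)) := by
  have hk := kappa_pos hp hc
  have hP : 0 < p * Real.pi ^ 2 := by have := Real.pi_pos; positivity
  filter_upwards [h.ae_hasDerivAt_y_sq_le hL hd] with t h1 ht
  obtain ⟨f', d1, l1⟩ := h1 ht
  refine ⟨f', d1, l1.trans ?_⟩
  set q := b + Real.exp (z t) with hq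
  have hq1 : 1 ≤ q := by linarith [Real.exp_pos (z t)]
  have hr1 : 1 ≤ q / a := by rw [le_div_iff₀ ha]; linarith
  have hM' : (q / a) ^ 3 / 4 ≤ q ^ 7 / (4 * a ^ 6) := by
    have e : q ^ 7 / (4 * a ^ 6) = (q / a) ^ 6 * q / 4 := by field_simp
    rw [e]
    have : (q / a) ^ 3 ≤ (q / a) ^ 6 := pow_le_pow_right₀ hr1 (by norm_num)
    have : (q / a) ^ 6 ≤ (q / a) ^ 6 * q := le_mul_of_one_le_right (by positivity) hq1
    linarith
  have hM : q / a / 4 ≤ q ^ 7 / (4 * a ^ 6) := by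
    have : q / a ≤ (q / a) ^ 3 := le_self_pow₀ hr1 (by norm_num)
    linarith
  have hE := h.energy_le hc hb ha ha1 hp hK hL hd hθc hθ ht.le
  have hexp : Real.exp (-kappa p c * t) * (‖w 0‖ ^ 2 + y 0 ^ 2) ≤ ‖w 0‖ ^ 2 + y 0 ^ 2 :=
    mul_le_of_le_one_left (by positivity) (Real.exp_le_one_iff.2 (by nlinarith))
  have hN := disturbance_le (X := ‖w t‖) (D := supNorm d) (Θ := supNorm θ)
    (E₀ := ‖w 0‖ ^ 2 + y 0 ^ 2) ha hb hp hc (by positivity) (by linarith [sq_nonneg (y t)])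
  have := output_dissipation (X := ‖w t‖) (Y := |y t|) hP hc (by positivity) hM hM' (norm_nonneg _)
    (abs_nonneg _) ((abs_apply_le_norm (θ t) 1).trans (norm_le_supNorm hθ hθc ht)) hN
  refine this.trans (le_of_eq ?_)
  rw [sq_abs]
  field_simp

theorem IsSolution.contDiffOn_exp_z (h : IsSolution ε Γ a b c p K L d θ w W y z) :
    ContDiffOn ℝ 1 (fun t => Real.exp (z t)) (Ici 0) :=
  h.z_contDiff.exp

/-- The factor e^{-z} of the update law cancels, giving the form of F' required by `gain_le`. -/
theorem IsSolution.hasDerivAt_exp_z (h : IsSolution ε Γ a b c p K L d θ w W y z) {t : ℝ}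
    (ht : 0 < t) : HasDerivAt (fun t => Real.exp (z t)) (Γ * max (y t ^ 2 / 2 - ε) 0) t := by
  convert! (h.z_eqn t ht).exp using 1
  rw [update, Real.exp_neg]
  field_simp

theorem IsSolution.z_mono (h : IsSolution ε Γ a b c p K L d θ w W y z) (hΓ : 0 < Γ) {t : ℝ}
    (ht : 0 ≤ t) : z 0 ≤ z t := by
  have hac : AbsolutelyContinuousOnInterval z 0 t :=
    ContDiffOn.absolutelyContinuousOnInterval
      (h.z_contDiff.mono (by rw [uIcc_of_le ht]; exact Icc_subset_Ici_self))
  have := le_of_absolutelyContinuous_of_deriv_nonpos ht hac.neg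
    (Eventually.of_forall fun x hx => ⟨_, (h.z_eqn x hx.1).neg, by
      have : 0 ≤ update ε Γ (y x) (z x) := by unfold update; positivity
      linarith⟩)
  simpa using this

/-- The bound on the gain. -/
theorem IsSolution.exp_z_le (h : IsSolution ε Γ a b c p K L d θ w W y z)
    (hε : 0 < ε) (hΓ : 0 < Γ) (hc : 1 ≤ c) (hb : 1 ≤ b) (ha : 0 < a) (ha1 : a ≤ 1) (hp : 0 < p)
    (hK : ∀ x ∈ Icc (0 : ℝ) 1, ∀ y : ℝ, |K x y| ≤ |y|) (hL : ∀ v : H2H10, |L v| ≤ ‖H2H10.toL2 v‖)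
    (hd : MemLp d ∞ (volume.restrict (Ici (0 : ℝ)))) (hθc : ContinuousOn θ (Ici 0))
    (hθ : MemLp θ ∞ (volume.restrict (Ici (0 : ℝ)))) {t : ℝ} (ht : 0 ≤ t) :
    Real.exp (z t) ≤ Real.exp (z 0) + Bbar ε Γ a b c p *
      (supNorm d ^ 2 + supNorm θ ^ 4 + supNorm θ ^ 8 + 2 * (p ^ 2)⁻¹
        + (‖w 0‖ ^ 2 + y 0 ^ 2)) := by
  have hder := h.ae_hasDerivAt_y_sq_le_attenuated hc hb ha ha1 hp hK hL hd hθc hθ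
  rw [Bbar_mul hε hc]
  set S := supNorm d ^ 2 + supNorm θ ^ 4 + supNorm θ ^ 8 + 2 * (p ^ 2)⁻¹
        + (‖w 0‖ ^ 2 + y 0 ^ 2) with hS
  have hS0 : 0 ≤ S := by positivity
  have hyS : y 0 ^ 2 ≤ S := by
    have : 0 ≤ supNorm d ^ 2 + supNorm θ ^ 4 + supNorm θ ^ 8 + 2 * (p ^ 2)⁻¹ + ‖w 0‖ ^ 2 := by
      positivity
    linarith
  have hKb := Kbar_pos ha hb hp hc
  set Q := a * Kbar a b c p * S with hQ
  have hQ0 : 0 ≤ Q := by positivity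
  have hac : ∀ s t, 0 ≤ s → s ≤ t → AbsolutelyContinuousOnInterval (fun t => y t ^ 2 / 2) s t := by
    intro s t hs hst
    have e : (fun t => y t ^ 2 / 2) = fun t => (1 / 2) * y t ^ 2 := by funext u; ring
    rw [e]
    exact (h.absolutelyContinuous_y_sq hs hst).const_mul _
  -- A crude bound on V suffices here: the attenuation factor is replaced by 1.
  have hVB : ∀ t ≥ 0, y t ^ 2 / 2 ≤ S / 2 + Q / (2 * c) := by
    intro t ht
    have := gronwall_Ici (f := fun t => y t ^ 2 / 2) (k := 2 * c) (R := Q) (by positivity)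
      ((h.y_continuous.pow 2).div_const 2) (fun s t hs => hac s t hs.le) (by
        filter_upwards [hder] with t h1 ht
        obtain ⟨f', d1, l1⟩ := h1 ht
        refine ⟨f', d1, l1.trans ?_⟩
        gcongr
        exact div_le_self hQ0 (by linarith [Real.exp_pos (z t)])) ht
    refine this.trans ?_
    have h1 : Real.exp (-(2 * c) * t) * (y 0 ^ 2 / 2) ≤ y 0 ^ 2 / 2 :=
      mul_le_of_le_one_left (by positivity) (Real.exp_le_one_iff.2 (by nlinarith))
    have h2 : 0 ≤ Real.exp (-(2 * c) * t) * (Q / (2 * c)) := by positivity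
    linarith
  have := gain_le (V := fun t => y t ^ 2 / 2) (F := fun t => Real.exp (z t)) (k := 2 * c) (Q := Q)
    hε hΓ.le (by positivity) (fun t _ => by positivity) hVB hac h.contDiffOn_exp_z
    (fun t => Real.exp_pos _) (fun t ht => h.hasDerivAt_exp_z ht) (by
      filter_upwards [hder] with t h1 ht
      obtain ⟨f', d1, l1⟩ := h1 ht
      refine ⟨f', d1, l1.trans ?_⟩
      gcongr
      linarith) hQ0 ht
  linarith

/-- The output is eventually almost confined to the deadzone. -/
theorem IsSolution.eventually_abs_y_le (h : IsSolution ε Γ a b c p K L d θ w W y z)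
    (hε : 0 < ε) (hΓ : 0 < Γ) (hc : 1 ≤ c) (hb : 1 ≤ b) (ha : 0 < a) (ha1 : a ≤ 1) (hp : 0 < p)
    (hK : ∀ x ∈ Icc (0 : ℝ) 1, ∀ y : ℝ, |K x y| ≤ |y|) (hL : ∀ v : H2H10, |L v| ≤ ‖H2H10.toL2 v‖)
    (hd : MemLp d ∞ (volume.restrict (Ici (0 : ℝ)))) (hθc : ContinuousOn θ (Ici 0))
    (hθ : MemLp θ ∞ (volume.restrict (Ici (0 : ℝ)))) {r : ℝ} (hr : Real.sqrt (2 * ε) < r) :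
    ∀ᶠ t in atTop, |y t| ≤ r := by
  have hr0 : 0 < r := (Real.sqrt_nonneg _).trans_lt hr
  have hr2 : 2 * ε < r ^ 2 := (Real.sqrt_lt' hr0).1 hr
  have hKb := Kbar_pos ha hb hp hc
  have hac : ∀ s t, 0 ≤ s → s ≤ t → AbsolutelyContinuousOnInterval (fun t => y t ^ 2 / 2) s t := by
    intro s t hs hst
    have e : (fun t => y t ^ 2 / 2) = fun t => (1 / 2) * y t ^ 2 := by funext u; ring
    rw [e]
    exact (h.absolutelyContinuous_y_sq hs hst).const_mul _
  have hev := eventually_le_of_bounded_gain (V := fun t => y t ^ 2 / 2)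
    (F := fun t => Real.exp (z t)) (ε := ε) hΓ hac h.contDiffOn_exp_z
    (fun t ht => h.exp_z_le hε hΓ hc hb ha ha1 hp hK hL hd hθc hθ ht)
    (fun t ht => h.hasDerivAt_exp_z ht) (Q := a * Kbar a b c p *
        (supNorm d ^ 2 + supNorm θ ^ 4 + supNorm θ ^ 8 + 2 * (p ^ 2)⁻¹ + (‖w 0‖ ^ 2 + y 0 ^ 2))) (by
      filter_upwards [h.ae_hasDerivAt_y_sq_le_attenuated hc hb ha ha1 hp hK hL hd hθc hθ]
        with t h1 ht
      obtain ⟨f', d1, l1⟩ := h1 ht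
      refine ⟨f', d1, l1.trans ?_⟩
      have h2 : 0 ≤ 2 * c * (y t ^ 2 / 2) := by positivity
      have h3 := div_le_self (a := a * Kbar a b c p * (supNorm d ^ 2 + supNorm θ ^ 4
        + supNorm θ ^ 8 + 2 * (p ^ 2)⁻¹ + (‖w 0‖ ^ 2 + y 0 ^ 2))) (b := b + Real.exp (z t))
        (by positivity) (by linarith [Real.exp_pos (z t)])
      linarith) (δ := r ^ 2 / 2 - ε) (by linarith)
  filter_upwards [hev] with t ht
  exact abs_le_of_sq_le_sq (by linarith) hr0.le

/-- Eventual bounds on the coefficient and on the output yield an eventual bound on the heat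
state. -/
theorem IsSolution.eventually_norm_le (h : IsSolution ε Γ a b c p K L d θ w W y z)
    (hp : 0 < p) (hK : ∀ x ∈ Icc (0 : ℝ) 1, ∀ y : ℝ, |K x y| ≤ |y|) {l r M : ℝ}
    (hl : ∀ᶠ t in atTop, |θ t 0| ≤ l) (hr : ∀ᶠ t in atTop, |y t| ≤ r) (hM0 : 0 ≤ M)
    (hM : l * r / (p * Real.pi ^ 2) < M) : ∀ᶠ t in atTop, ‖w t‖ ≤ M := by
  have hP : 0 < p * Real.pi ^ 2 := by have := Real.pi_pos; positivity
  obtain ⟨T, hT⟩ := eventually_atTop.1 ((hl.and hr).and (eventually_gt_atTop 0))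
  have hT0 : 0 < T := (hT T le_rfl).2
  have hl0 : 0 ≤ l := (abs_nonneg _).trans (hT T le_rfl).1.1
  have hr0 : 0 ≤ r := (abs_nonneg _).trans (hT T le_rfl).1.2
  have hder := fun x hx => h.hasDerivAt_norm_sq_le hp hK (t := x) hx
  generalize p * Real.pi ^ 2 = P at *
  set m := l * r with hm
  have hm0 : 0 ≤ m := mul_nonneg hl0 hr0
  have key : ∀ t ≥ T, ‖w t‖ ^ 2 ≤ Real.exp (-P * (t - T)) * (‖w T‖ ^ 2 - m ^ 2 / P / P)
      + m ^ 2 / P / P := by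
    intro t ht
    refine gronwall_of_absolutelyContinuous (f := fun t => ‖w t‖ ^ 2) hP.ne' ht
      (h.absolutelyContinuous_norm_sq hT0 ht) (Eventually.of_forall fun x hx => ?_)
    obtain ⟨f', d1, l1⟩ := hder x (hT0.trans hx.1)
    refine ⟨f', d1, l1.trans ?_⟩
    obtain ⟨⟨b1, b2⟩, -⟩ := hT x hx.1.le
    have h1 : |θ x 0| * |y x| * ‖w x‖ ≤ m * ‖w x‖ := by
      rw [hm]; gcongr
    -- Half of the dissipation 2P is spent, leaving rate P and source m²/P, with equilibrium (m/P)².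
    have h2 : 2 * (m * ‖w x‖) ≤ P * ‖w x‖ ^ 2 + m ^ 2 / P := by
      have e : P * ‖w x‖ ^ 2 + m ^ 2 / P = ((P * ‖w x‖) ^ 2 + m ^ 2) / P := by field_simp
      rw [e, le_div_iff₀ hP]
      nlinarith [sq_nonneg (P * ‖w x‖ - m)]
    linarith
  have lim : Tendsto (fun t => Real.exp (-P * (t - T)) * (‖w T‖ ^ 2 - m ^ 2 / P / P)
      + m ^ 2 / P / P) atTop (𝓝 (0 * (‖w T‖ ^ 2 - m ^ 2 / P / P) + m ^ 2 / P / P)) := by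
    refine Tendsto.add_const _ (Tendsto.mul_const _ (Real.tendsto_exp_atBot.comp ?_))
    exact Tendsto.const_mul_atTop_of_neg (neg_lt_zero.2 hP)
      (tendsto_atTop_add_const_right _ _ tendsto_id)
  have hlt : 0 * (‖w T‖ ^ 2 - m ^ 2 / P / P) + m ^ 2 / P / P < M ^ 2 := by
    have e : 0 * (‖w T‖ ^ 2 - m ^ 2 / P / P) + m ^ 2 / P / P = (m / P) ^ 2 := by
      field_simp; ring
    rw [e]
    exact pow_lt_pow_left₀ hM (by positivity) (by norm_num)
  filter_upwards [lim.eventually (gt_mem_nhds hlt), eventually_ge_atTop T] with t h1 h2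
  exact abs_le_of_sq_le_sq' ((key t h2).trans h1.le) hM0 |>.2

end Solution

end DADS

/-! ### Assembly of the bounds and passage to limsups. -/

theorem theorem3 (ε Γ a b c : ℝ) (hε : 0 < ε) (hΓ : 0 < Γ) (hc : 1 ≤ c) (hb : 1 ≤ b)
    (ha : 0 < a) (ha1 : a ≤ 1)
    (p : ℝ) (hp : 0 < p)
    (K : ℝ → ℝ → ℝ) (hK : ∀ x ∈ Icc (0 : ℝ) 1, ∀ y : ℝ, |K x y| ≤ |y|)
    (L : DADS.H2H10 → ℝ) (hL : ∀ v : DADS.H2H10, |L v| ≤ ‖DADS.H2H10.toL2 v‖)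
    (d : ℝ → ℝ) (hd : MemLp d ∞ (volume.restrict (Ici (0 : ℝ))))
    (θ : ℝ → EuclideanSpace ℝ (Fin 2)) (hθc : ContinuousOn θ (Ici 0))
    (hθ : MemLp θ ∞ (volume.restrict (Ici (0 : ℝ))))
    (w : ℝ → DADS.L2) (W : ℝ → DADS.H2H10) (y z : ℝ → ℝ)
    (hsol : DADS.IsSolution ε Γ a b c p K L d θ w W y z) :
    (∀ t ≥ 0, ‖w t‖ ^ 2 + y t ^ 2 ≤
        Real.exp (-DADS.kappa p c * t) * (‖w 0‖ ^ 2 + y 0 ^ 2)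
        + 2 * a * ((DADS.supNorm d ^ 2 + DADS.supNorm θ ^ 8 + 2 * (p ^ 2)⁻¹)
            / (b * DADS.kappa p c))
        + DADS.supNorm θ ^ 4 / (2 * p ^ 2 * Real.pi ^ 4 * DADS.kappa p c)) ∧
    (∀ t ≥ 0, z 0 ≤ z t ∧
        z t ≤ Real.log (Real.exp (z 0) + DADS.Bbar ε Γ a b c p *
          (DADS.supNorm d ^ 2 + DADS.supNorm θ ^ 4 + DADS.supNorm θ ^ 8 + 2 * (p ^ 2)⁻¹
            + ‖w 0‖ ^ 2 + y 0 ^ 2))) ∧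
    limsup (fun t => ‖w t‖) atTop ≤
        Real.sqrt (2 * ε) / (p * Real.pi ^ 2) * limsup (fun t => |θ t 0|) atTop ∧
    limsup (fun t => |y t|) atTop ≤ Real.sqrt (2 * ε) := by
  have hy : ∀ r, Real.sqrt (2 * ε) < r → ∀ᶠ t in atTop, |y t| ≤ r := fun r hr =>
    hsol.eventually_abs_y_le hε hΓ hc hb ha ha1 hp hK hL hd hθc hθ hr
  have hcob : ∀ f : ℝ → ℝ, (∀ t, 0 ≤ f t) → IsCoboundedUnder (· ≤ ·) atTop f := fun f hf =>
    isCoboundedUnder_le_of_le atTop hf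
  refine ⟨fun t ht => hsol.energy_le hc hb ha ha1 hp hK hL hd hθc hθ ht,
    fun t ht => ⟨hsol.z_mono hΓ ht, ?_⟩, ?_, ?_⟩
  · have := hsol.exp_z_le hε hΓ hc hb ha ha1 hp hK hL hd hθc hθ ht
    rw [← add_assoc] at this
    exact (Real.le_log_iff_exp_le ((Real.exp_pos _).trans_le this)).2 this
  · set ℓ := limsup (fun t => |θ t 0|) atTop with hℓ
    have hbdd : IsBoundedUnder (· ≤ ·) atTop (fun t => |θ t 0|) :=
      ⟨DADS.supNorm θ, by
        simp only [eventually_map]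
        filter_upwards [eventually_gt_atTop 0] with t ht
        exact (DADS.abs_apply_le_norm _ _).trans (DADS.norm_le_supNorm hθ hθc ht)⟩
    have hℓ0 : 0 ≤ ℓ := le_limsup_of_frequently_le (Frequently.of_forall fun t => abs_nonneg _) hbdd
    refine le_of_forall_gt_imp_ge_of_dense fun M hM => ?_
    have hM0 : 0 ≤ M := le_trans (by positivity) hM.le
    -- The limsups of |θ₁| and |y| give eventual bounds only up to a margin δ, small enough to keep
    -- the product below M.
    have lim : Tendsto (fun δ : ℝ => (ℓ + δ) * (Real.sqrt (2 * ε) + δ) / (p * Real.pi ^ 2)) (𝓝[>] 0)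
        (𝓝 ((ℓ + 0) * (Real.sqrt (2 * ε) + 0) / (p * Real.pi ^ 2))) := by
      refine Tendsto.mono_left (Continuous.tendsto ?_ 0) nhdsWithin_le_nhds
      fun_prop
    have hlt : (ℓ + 0) * (Real.sqrt (2 * ε) + 0) / (p * Real.pi ^ 2) < M := by
      refine lt_of_eq_of_lt ?_ hM
      ring
    obtain ⟨δ, hδM, hδ⟩ := ((lim.eventually (gt_mem_nhds hlt)).and self_mem_nhdsWithin).exists
    have hδ : 0 < δ := hδ
    refine limsup_le_of_le (hcob _ fun t => norm_nonneg _) ?_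
    refine hsol.eventually_norm_le hp hK ?_ (hy (Real.sqrt (2 * ε) + δ) (by linarith)) hM0 hδM
    have : limsup (fun t => |θ t 0|) atTop < ℓ + δ := by linarith
    exact (eventually_lt_of_limsup_lt this hbdd).mono fun t ht => ht.le
  · refine le_of_forall_gt_imp_ge_of_dense fun r hr => ?_
    exact limsup_le_of_le (hcob _ fun t => abs_nonneg _) (hy r hr)
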